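/- Let $(M,g)$ be a smooth Riemannian manifold of dimension $n\ge 3$ with Levi-Civita connection $\nabla$, Ricci tensor $\mathrm{Ric}$ and scalar curvature $\mathrm{scal}$. Suppose that $(V,\lambda)$ defines an almost Einstein soliton on $(M,g)$, i.e. $V$ is a nowhere vanishing smooth vector field and $\lambda$ a smooth function on $M$ with $$\tfrac12\,\mathcal L_V g+\mathrm{Ric}=\Big(\tfrac{\mathrm{scal}}{2}+\lambda\Big)g .$$ (1) Suppose that $V$ is torse-forming, $\nabla V=aI+\psi\otimes V$ (that is, $\nabla_XV=aX+\psi(X)V$ for every vector field $X$), where $a$ is a smooth function and $\psi$ a smooth $1$-form, and that $\psi$ is a Codazzi tensor field, i.e. $(\nabla_X\psi)Y=(\nabla_Y\psi)X$ for all vector fields $X,Y$. Then $$\lambda=a+\frac{(n-1)(n-2)}{2|V|^2}V(a)-\frac{1}{2|V|^2}\big[(n-1)(n-2)a+(n-3)|V|^2\big]\psi(V).$$ (2) Suppose that $V$ is concircular, $\nabla V=aI$, with $a$ a nonzero constant. Then $\lambda=a$, and $M$ is Ricci-flat, i.e. $\mathrm{Ric}=0$. -/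

import Mathlib

open Bundle VectorField
open scoped Manifold ContDiff

noncomputable section

namespace RiemGeom

section Connection

variable {E : Type*} [NormedAddCommGroup E] [NormedSpace ℝ E]
  {H : Type*} [TopologicalSpace H] {I : ModelWithCorners ℝ E H}
  {M : Type*} [TopologicalSpace M] [ChartedSpace H M] [IsManifold I ∞ M]
  [RiemannianBundle (fun x : M => TangentSpace I x)]

/-- The right-hand side of Koszul's formula for `2 g(∇_X Y, Z)`. -/
def koszul (X Y Z : Π x : M, TangentSpace I x) (x : M) : ℝ :=
  mvfderiv I (fun y => inner ℝ (Y y) (Z y)) x (X x)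
    + mvfderiv I (fun y => inner ℝ (X y) (Z y)) x (Y x)
    - mvfderiv I (fun y => inner ℝ (X y) (Y y)) x (Z x)
    + inner ℝ (mlieBracket I X Y x) (Z x)
    - inner ℝ (mlieBracket I X Z x) (Y x)
    - inner ℝ (mlieBracket I Y Z x) (X x)

variable [IsContMDiffRiemannianBundle I ∞ E (fun x : M => TangentSpace I x)]

theorem mdiff_inner {X Y : Π x : M, TangentSpace I x} {x : M} (hX : MDiffAt (T% X) x)
    (hY : MDiffAt (T% Y) x) : MDiffAt (fun y => inner ℝ (X y) (Y y)) x :=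
  MDifferentiableAt.inner_bundle (F := E) (E := fun x : M => TangentSpace I x) (b := fun y => y)
    hX hY

variable [FiniteDimensional ℝ E]

theorem koszul_tensorial_left {Y Z : Π x : M, TangentSpace I x} {x : M}
    (hY : MDiffAt (T% Y) x) (hZ : MDiffAt (T% Z) x) :
    TensorialAt I E (fun X : Π x : M, TangentSpace I x => koszul X Y Z x) x where
  smul {f X} hf hX := by
    have := FiniteDimensional.complete ℝ E
    simp only [koszul]
    have h1 : (fun y => inner ℝ ((f • X) y) (Z y)) = fun y => f y * inner ℝ (X y) (Z y) := by
      ext y; simp [inner_smul_left]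
    have h2 : (fun y => inner ℝ ((f • X) y) (Y y)) = fun y => f y * inner ℝ (X y) (Y y) := by
      ext y; simp [inner_smul_left]
    rw [h1, h2, mvfderiv_fun_mul hf (mdiff_inner hX hZ), mvfderiv_fun_mul hf (mdiff_inner hX hY),
      mlieBracket_smul_left hf hX, mlieBracket_smul_left hf hX]
    simp [inner_add_left, inner_smul_left, inner_smul_right]
    ring
  add {X X'} hX hX' := by
    have := FiniteDimensional.complete ℝ E
    simp only [koszul]
    have h1 : (fun y => inner ℝ ((X + X') y) (Z y))
        = fun y => inner ℝ (X y) (Z y) + inner ℝ (X' y) (Z y) := by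
      ext y; simp [inner_add_left]
    have h2 : (fun y => inner ℝ ((X + X') y) (Y y))
        = fun y => inner ℝ (X y) (Y y) + inner ℝ (X' y) (Y y) := by
      ext y; simp [inner_add_left]
    rw [h1, h2, mvfderiv_fun_add (mdiff_inner hX hZ) (mdiff_inner hX' hZ),
      mvfderiv_fun_add (mdiff_inner hX hY) (mdiff_inner hX' hY),
      mlieBracket_add_left hX hX', mlieBracket_add_left hX hX']
    simp [inner_add_left, inner_add_right]
    ring

theorem koszul_tensorial_right {X Y : Π x : M, TangentSpace I x} {x : M}
    (hX : MDiffAt (T% X) x) (hY : MDiffAt (T% Y) x) :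
    TensorialAt I E (fun Z : Π x : M, TangentSpace I x => koszul X Y Z x) x where
  smul {f Z} hf hZ := by
    have := FiniteDimensional.complete ℝ E
    simp only [koszul]
    have h1 : (fun y => inner ℝ (Y y) ((f • Z) y)) = fun y => f y * inner ℝ (Y y) (Z y) := by
      ext y; simp [inner_smul_right]
    have h2 : (fun y => inner ℝ (X y) ((f • Z) y)) = fun y => f y * inner ℝ (X y) (Z y) := by
      ext y; simp [inner_smul_right]
    rw [h1, h2, mvfderiv_fun_mul hf (mdiff_inner hY hZ), mvfderiv_fun_mul hf (mdiff_inner hX hZ),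
      mlieBracket_smul_right hf hZ, mlieBracket_smul_right hf hZ]
    simp [inner_add_left, inner_smul_left, inner_smul_right]
    rw [real_inner_comm (Y x) (Z x), real_inner_comm (X x) (Z x)]
    ring
  add {Z Z'} hZ hZ' := by
    have := FiniteDimensional.complete ℝ E
    simp only [koszul]
    have h1 : (fun y => inner ℝ (Y y) ((Z + Z') y))
        = fun y => inner ℝ (Y y) (Z y) + inner ℝ (Y y) (Z' y) := by
      ext y; simp [inner_add_right]
    have h2 : (fun y => inner ℝ (X y) ((Z + Z') y))
        = fun y => inner ℝ (X y) (Z y) + inner ℝ (X y) (Z' y) := by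
      ext y; simp [inner_add_right]
    rw [h1, h2, mvfderiv_fun_add (mdiff_inner hY hZ) (mdiff_inner hY hZ'),
      mvfderiv_fun_add (mdiff_inner hX hZ) (mdiff_inner hX hZ'),
      mlieBracket_add_right hZ hZ', mlieBracket_add_right hZ hZ']
    simp [inner_add_left, inner_add_right]
    ring

theorem koszul_add {X Y Y' Z : Π x : M, TangentSpace I x} {x : M}
    (hX : MDiffAt (T% X) x) (hY : MDiffAt (T% Y) x) (hY' : MDiffAt (T% Y') x)
    (hZ : MDiffAt (T% Z) x) :
    koszul X (Y + Y') Z x = koszul X Y Z x + koszul X Y' Z x := by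
  have := FiniteDimensional.complete ℝ E
  simp only [koszul]
  have h1 : (fun y => inner ℝ ((Y + Y') y) (Z y))
      = fun y => inner ℝ (Y y) (Z y) + inner ℝ (Y' y) (Z y) := by
    ext y; simp [inner_add_left]
  have h2 : (fun y => inner ℝ (X y) ((Y + Y') y))
      = fun y => inner ℝ (X y) (Y y) + inner ℝ (X y) (Y' y) := by
    ext y; simp [inner_add_right]
  rw [h1, h2, mvfderiv_fun_add (mdiff_inner hY hZ) (mdiff_inner hY' hZ),
    mvfderiv_fun_add (mdiff_inner hX hY) (mdiff_inner hX hY'),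
    mlieBracket_add_left hY hY', mlieBracket_add_right hY hY']
  simp [inner_add_left, inner_add_right]
  ring

theorem koszul_smul {X Y Z : Π x : M, TangentSpace I x} {f : M → ℝ} {x : M}
    (hX : MDiffAt (T% X) x) (hY : MDiffAt (T% Y) x) (hZ : MDiffAt (T% Z) x)
    (hf : MDiffAt f x) :
    koszul X (f • Y) Z x
      = f x * koszul X Y Z x + 2 * mvfderiv I f x (X x) * inner ℝ (Y x) (Z x) := by
  have := FiniteDimensional.complete ℝ E
  simp only [koszul]
  have h1 : (fun y => inner ℝ ((f • Y) y) (Z y)) = fun y => f y * inner ℝ (Y y) (Z y) := by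
    ext y; simp [inner_smul_left]
  have h2 : (fun y => inner ℝ (X y) ((f • Y) y)) = fun y => f y * inner ℝ (X y) (Y y) := by
    ext y; simp [inner_smul_right]
  rw [h1, h2, mvfderiv_fun_mul hf (mdiff_inner hY hZ), mvfderiv_fun_mul hf (mdiff_inner hX hY),
    mlieBracket_smul_left hf hY, mlieBracket_smul_right hf hY]
  simp [inner_add_left, inner_smul_left, inner_smul_right]
  rw [real_inner_comm (Y x) (X x)]
  ring

/-- The bilinear form `(u, w) ↦ 2 g(∇_u Y, w)` on the tangent space at `x`. -/
def koszulForm (Y : Π x : M, TangentSpace I x) (x : M) (hY : MDiffAt (T% Y) x) :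
    TangentSpace I x →L[ℝ] TangentSpace I x →L[ℝ] ℝ :=
  TensorialAt.mkHom₂ (fun X Z => koszul X Y Z x) x
    (fun _ hZ => koszul_tensorial_left hY hZ) (fun _ hX => koszul_tensorial_right hX hY)

theorem koszulForm_apply {X Y Z : Π x : M, TangentSpace I x} {x : M}
    (hX : MDiffAt (T% X) x) (hY : MDiffAt (T% Y) x) (hZ : MDiffAt (T% Z) x) :
    koszulForm Y x hY (X x) (Z x) = koszul X Y Z x :=
  TensorialAt.mkHom₂_apply _ _ hX hZ

instance finiteDimensional_tangentSpace (x : M) : FiniteDimensional ℝ (TangentSpace I x) :=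
  inferInstanceAs (FiniteDimensional ℝ E)

instance completeSpace_tangentSpace (x : M) : CompleteSpace (TangentSpace I x) :=
  FiniteDimensional.complete ℝ _

open Classical in
/-- The vector `∇_u Y` at `x`, for `u` tangent at `x`; junk value `0` if `Y` is not differentiable
at `x`. -/
def leviCivitaFun (Y : Π x : M, TangentSpace I x) (x : M) :
    TangentSpace I x →L[ℝ] TangentSpace I x :=
  if hY : MDiffAt (T% Y) x then
    (1 / 2 : ℝ) • InnerProductSpace.continuousLinearMapOfBilin (𝕜 := ℝ) (koszulForm Y x hY)
  else 0

theorem inner_leviCivitaFun {X Y Z : Π x : M, TangentSpace I x} {x : M}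
    (hX : MDiffAt (T% X) x) (hY : MDiffAt (T% Y) x) (hZ : MDiffAt (T% Z) x) :
    inner ℝ (leviCivitaFun Y x (X x)) (Z x) = (1 / 2) * koszul X Y Z x := by
  rw [leviCivitaFun, dif_pos hY, ← koszulForm_apply hX hY hZ]
  simp [inner_smul_left, InnerProductSpace.continuousLinearMapOfBilin_apply]

theorem leviCivitaFun_eq {X Y : Π x : M, TangentSpace I x} {x : M} {v : TangentSpace I x}
    (hX : MDiffAt (T% X) x) (hY : MDiffAt (T% Y) x)
    (h : ∀ Z : Π x : M, TangentSpace I x, MDiffAt (T% Z) x →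
      inner ℝ v (Z x) = (1 / 2) * koszul X Y Z x) :
    leviCivitaFun Y x (X x) = v := by
  refine ext_inner_right ℝ fun w => ?_
  have hw : MDiffAt (T% (FiberBundle.extend E w)) x := FiberBundle.mdifferentiableAt_extend ..
  have h1 := inner_leviCivitaFun hX hY hw
  rw [← h _ hw] at h1
  simpa using h1

/-- The Levi-Civita connection; `leviCivita Y x (X x)` is `∇_X Y` at `x`. -/
def leviCivita : CovariantDerivative I E (fun x : M => TangentSpace I x) where
  toFun := leviCivitaFun
  isCovariantDerivativeOnUniv :=
    { add := by
        intro Y Y' x hY hY' _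
        ext u
        have hu : MDiffAt (T% (FiberBundle.extend E u)) x :=
          FiberBundle.mdifferentiableAt_extend ..
        have hs : MDiffAt (T% (Y + Y')) x := mdifferentiableAt_add_section hY hY'
        have := leviCivitaFun_eq (v := leviCivitaFun Y x u + leviCivitaFun Y' x u) hu hs
          fun Z hZ => by
            have h1 := inner_leviCivitaFun hu hY hZ
            have h2 := inner_leviCivitaFun hu hY' hZ
            simp only [FiberBundle.extend_apply_self] at h1 h2
            rw [koszul_add hu hY hY' hZ, inner_add_left, h1, h2]
            ring
        simpa using this
      leibniz := by
        intro Y f x hY hf _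
        ext u
        have hu : MDiffAt (T% (FiberBundle.extend E u)) x :=
          FiberBundle.mdifferentiableAt_extend ..
        have hs : MDiffAt (T% (f • Y)) x := hf.smul_section hY
        have := leviCivitaFun_eq
          (v := f x • leviCivitaFun Y x u + mvfderiv I f x u • Y x) hu hs
          fun Z hZ => by
            have h1 := inner_leviCivitaFun hu hY hZ
            simp only [FiberBundle.extend_apply_self] at h1
            rw [koszul_smul hu hY hZ hf, inner_add_left, inner_smul_left, inner_smul_left, h1]
            simp
            ring
        simpa using this }

theorem inner_leviCivita {X Y Z : Π x : M, TangentSpace I x} {x : M}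
    (hX : MDiffAt (T% X) x) (hY : MDiffAt (T% Y) x) (hZ : MDiffAt (T% Z) x) :
    inner ℝ (leviCivita Y x (X x)) (Z x) = (1 / 2) * koszul X Y Z x :=
  inner_leviCivitaFun hX hY hZ

/-- The connection is compatible with the metric. -/
theorem leviCivita_metric {X Y Z : Π x : M, TangentSpace I x} {x : M}
    (hX : MDiffAt (T% X) x) (hY : MDiffAt (T% Y) x) (hZ : MDiffAt (T% Z) x) :
    mvfderiv I (fun y => inner ℝ (Y y) (Z y)) x (X x)
      = inner ℝ (leviCivita Y x (X x)) (Z x) + inner ℝ (Y x) (leviCivita Z x (X x)) := by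
  rw [real_inner_comm _ (Y x), inner_leviCivita hX hY hZ, inner_leviCivita hX hZ hY]
  have h : (fun y => inner ℝ (Z y) (Y y)) = fun y => inner ℝ (Y y) (Z y) := by
    ext y; rw [real_inner_comm]
  simp only [koszul, h]
  rw [mlieBracket_swap (V := Z) (W := Y)]
  simp
  ring

/-- The connection is torsion-free. -/
theorem leviCivita_torsionFree {X Y : Π x : M, TangentSpace I x} {x : M}
    (hX : MDiffAt (T% X) x) (hY : MDiffAt (T% Y) x) :
    leviCivita Y x (X x) - leviCivita X x (Y x) = mlieBracket I X Y x := by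
  refine ext_inner_right ℝ fun w => ?_
  have hw : MDiffAt (T% (FiberBundle.extend E w)) x := FiberBundle.mdifferentiableAt_extend ..
  have h1 := inner_leviCivita hX hY hw
  have h2 := inner_leviCivita hY hX hw
  have h : (fun y => inner ℝ (Y y) (X y)) = fun y => inner ℝ (X y) (Y y) := by
    ext y; rw [real_inner_comm]
  simp only [FiberBundle.extend_apply_self, koszul, h] at h1 h2
  rw [mlieBracket_swap (V := Y) (W := X)] at h2
  rw [inner_sub_left, h1, h2]
  simp
  ring

end Connection

section Curvature

variable {E : Type*} [NormedAddCommGroup E] [NormedSpace ℝ E] [FiniteDimensional ℝ E]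
  {H : Type*} [TopologicalSpace H] {I : ModelWithCorners ℝ E H}
  {M : Type*} [TopologicalSpace M] [ChartedSpace H M] [IsManifold I ∞ M]
  [RiemannianBundle (fun x : M => TangentSpace I x)]
  [IsContMDiffRiemannianBundle I ∞ E (fun x : M => TangentSpace I x)]

/-- The vector field `∇_X Y`. -/
def nabla (X Y : Π x : M, TangentSpace I x) : Π x : M, TangentSpace I x :=
  fun x => leviCivita Y x (X x)

/-- The Riemann curvature `R(X, Y)Z = ∇_X ∇_Y Z - ∇_Y ∇_X Z - ∇_[X, Y] Z`. -/
def curvature (X Y Z : Π x : M, TangentSpace I x) : Π x : M, TangentSpace I x :=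
  nabla X (nabla Y Z) - nabla Y (nabla X Z) - nabla (mlieBracket I X Y) Z

/-- The Ricci tensor `Ric(Y, Z)(x) = ∑ i, g(R(eᵢ, Y)Z, eᵢ)`, i.e. the trace of `u ↦ R(u, Y)Z` on
the tangent space at `x`, for an orthonormal basis `eᵢ` of that space. The vectors `eᵢ` are
extended to vector fields that are smooth near `x`; as `R` is tensorial, the choice of the
extension is irrelevant when `Y` and `Z` are smooth near `x`. -/
def ricci (Y Z : Π x : M, TangentSpace I x) (x : M) : ℝ :=
  ∑ i, inner ℝ
    (curvature (FiberBundle.extend E (stdOrthonormalBasis ℝ (TangentSpace I x) i)) Y Z x)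
    (stdOrthonormalBasis ℝ (TangentSpace I x) i)

variable (I) in
/-- The scalar curvature `∑ i, Ric(eᵢ, eᵢ)` for an orthonormal basis `eᵢ` at `x`. -/
def scal (x : M) : ℝ :=
  ∑ i, ricci (I := I) (FiberBundle.extend E (stdOrthonormalBasis ℝ (TangentSpace I x) i))
    (FiberBundle.extend E (stdOrthonormalBasis ℝ (TangentSpace I x) i)) x

/-- The Lie derivative of the metric,
`(L_V g)(X, Y) = V(g(X, Y)) - g([V, X], Y) - g(X, [V, Y])`. -/
def lieDerivMetric (V X Y : Π x : M, TangentSpace I x) (x : M) : ℝ :=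
  mvfderiv I (fun y => inner ℝ (X y) (Y y)) x (V x)
    - inner ℝ (mlieBracket I V X x) (Y x) - inner ℝ (X x) (mlieBracket I V Y x)

/-- `(V, lam)` defines an almost Einstein soliton: `V` is a smooth vector field without zeros,
`lam` is a smooth function, and `(1/2) L_V g + Ric = (scal/2 + lam) g`. -/
structure IsAlmostEinsteinSoliton (V : Π x : M, TangentSpace I x) (lam : M → ℝ) : Prop where
  contMDiff_field : ContMDiff I I.tangent ∞ (T% V)
  ne_zero : ∀ x, V x ≠ 0
  contMDiff_fun : ContMDiff I 𝓘(ℝ) ∞ lam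
  soliton_eq : ∀ X Y : Π x : M, TangentSpace I x,
    ContMDiff I I.tangent ∞ (T% X) → ContMDiff I I.tangent ∞ (T% Y) → ∀ x,
      (1 / 2) * lieDerivMetric V X Y x + ricci X Y x
        = (scal I x / 2 + lam x) * inner ℝ (X x) (Y x)

/-- `ψ` is a smooth 1-form on `M`. -/
def IsSmoothOneForm (ψ : Π x : M, TangentSpace I x →L[ℝ] ℝ) : Prop :=
  ContMDiff I (I.prod 𝓘(ℝ, E →L[ℝ] ℝ)) ∞
    (fun x => TotalSpace.mk' (E →L[ℝ] ℝ) (E := fun x : M => TangentSpace I x →L[ℝ] ℝ) x (ψ x))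

/-- `∇V = a I + ψ ⊗ V`, that is, `∇_u V = a u + ψ(u) V` for all tangent vectors `u`. -/
def IsTorseForming (V : Π x : M, TangentSpace I x) (a : M → ℝ)
    (ψ : Π x : M, TangentSpace I x →L[ℝ] ℝ) : Prop :=
  ∀ (x : M) (u : TangentSpace I x), leviCivita V x u = a x • u + ψ x u • V x

/-- `∇V = a I`. -/
def IsConcircular (V : Π x : M, TangentSpace I x) (a : M → ℝ) : Prop :=
  ∀ (x : M) (u : TangentSpace I x), leviCivita V x u = a x • u

/-- The covariant derivative of a 1-form, `(∇_X ψ)Y = X(ψ(Y)) - ψ(∇_X Y)`. -/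
def nablaOneForm (X : Π x : M, TangentSpace I x) (ψ : Π x : M, TangentSpace I x →L[ℝ] ℝ)
    (Y : Π x : M, TangentSpace I x) (x : M) : ℝ :=
  mvfderiv I (fun y => ψ y (Y y)) x (X x) - ψ x (nabla X Y x)

/-- `ψ` is a Codazzi tensor field: `(∇_X ψ)Y = (∇_Y ψ)X` for all vector fields `X`, `Y`. -/
def IsCodazzi (ψ : Π x : M, TangentSpace I x →L[ℝ] ℝ) : Prop :=
  ∀ X Y : Π x : M, TangentSpace I x,
    ContMDiff I I.tangent ∞ (T% X) → ContMDiff I I.tangent ∞ (T% Y) → ∀ x,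
      nablaOneForm X ψ Y x = nablaOneForm Y ψ X x

variable (I M) in
/-- `Ric = 0`. -/
def IsRicciFlat : Prop :=
  ∀ X Y : Π x : M, TangentSpace I x,
    ContMDiff I I.tangent ∞ (T% X) → ContMDiff I I.tangent ∞ (T% Y) → ∀ x, ricci X Y x = 0

end Curvature

end RiemGeom

end

/-!
Write `∇V = a I + ψ ⊗ V` and `θ = da - a ψ`. Differentiating once more and using that the
connection is torsion-free and that `ψ` is Codazzi, the terms along `V` cancel in the curvature,
which leaves `R(X, Y)V = θ(X) Y - θ(Y) X` (`curvature_torseForming`). Taking the trace in `X`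
gives `Ric(Y, V) = -(n - 1) θ(Y)` (`ricci_torseForming`).

As `(L_V g)(X, Y) = g(∇_X V, Y) + g(X, ∇_Y V)`, the soliton equation reads `Ric = (scal / 2 + λ -
a) g - (ψ ⊗ V♭ + V♭ ⊗ ψ) / 2` (`ricci_eq`). Its trace (`scal_eq`) and its value at `(V, V)`, where
the Ricci term is known, are two linear equations for `scal` and `λ`; eliminating `scal` gives the
formula for `λ` (`lam_eq`). If `∇V = c I`, the same formula with `ψ = 0` gives `λ = c`, the trace
gives `(n - 2) scal = 0`, and what remains of the soliton equation is `Ric = 0`.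

The frame `eᵢ` in the definitions of `ricci` and `scal` is extended by fields that are smooth only
near the base point, while the soliton equation and the Codazzi condition concern globally smooth
fields. The two are reconciled by the locality of the curvature (`curvature_congr`) and by
replacing each local extension by a global field with the same germ
(`exists_contMDiff_eventuallyEq_extend`).
-/

namespace RiemGeom

/-! ### Traces over an orthonormal basis -/

section Traces

variable {F : Type*} [NormedAddCommGroup F] [InnerProductSpace ℝ F]
  {ι : Type*} [Fintype ι]

theorem sum_clm_mul_inner (b : OrthonormalBasis ι ℝ F) (φ : F →L[ℝ] ℝ) (v : F) :
    ∑ i, φ (b i) * inner ℝ v (b i) = φ v := by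
  conv_rhs => rw [← b.sum_repr v]
  simp [b.repr_apply_apply, real_inner_comm, mul_comm]

theorem sum_inner_self (b : OrthonormalBasis ι ℝ F) :
    ∑ i, inner ℝ (b i) (b i) = (Fintype.card ι : ℝ) := by
  simp

end Traces

variable {E : Type*} [NormedAddCommGroup E] [NormedSpace ℝ E]
  {H : Type*} [TopologicalSpace H] {I : ModelWithCorners ℝ E H}
  {M : Type*} [TopologicalSpace M] [ChartedSpace H M] [IsManifold I ∞ M]

/-! ### Smooth fields and 1-forms -/

theorem mdifferentiableAt_oneForm_apply {ψ : Π x : M, TangentSpace I x →L[ℝ] ℝ}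
    {Y : Π x : M, TangentSpace I x} (hψ : IsSmoothOneForm ψ)
    (hY : ContMDiff I I.tangent ∞ (T% Y)) (x : M) : MDiffAt (fun y => ψ y (Y y)) x := by
  have h := ContMDiffAt.clm_bundle_apply (F₁ := E) (F₂ := ℝ) (E₁ := fun x : M => TangentSpace I x)
    (E₂ := Bundle.Trivial M ℝ) (b := fun y : M => y) (v := Y) (ϕ := ψ) (hψ x) (hY x)
  rw [contMDiffAt_section] at h
  exact h.mdifferentiableAt (by simp)

variable [FiniteDimensional ℝ E]

/-- Bump functions turn the extension `FiberBundle.extend E v`, which is smooth only near `x`, into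
a globally smooth vector field with the same germ at `x`. -/
theorem exists_contMDiff_eventuallyEq_extend [T2Space M] {x : M} (v : TangentSpace I x) :
    ∃ X : Π x : M, TangentSpace I x, ContMDiff I I.tangent ∞ (T% X) ∧
      ∀ᶠ y in nhds x, FiberBundle.extend E v y = X y := by
  obtain ⟨s, hs, hsmooth⟩ := FiberBundle.exists_contMDiffOn_extend (k := ∞) I E v
  obtain ⟨f, hf, -⟩ := (SmoothBumpFunction.nhds_basis_support (I := I)
    (interior_mem_nhds.2 hs)).mem_iff.1 (Filter.univ_mem (f := nhds x))
  refine ⟨fun y => f y • FiberBundle.extend E v y,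
    ContMDiffOn.smul_section_of_tsupport f.contMDiff.contMDiffOn isOpen_interior hf
      (hsmooth.mono interior_subset), ?_⟩
  filter_upwards [f.eventuallyEq_one] with y hy
  simp [hy]

variable [RiemannianBundle (fun x : M => TangentSpace I x)]
  [IsContMDiffRiemannianBundle I ∞ E (fun x : M => TangentSpace I x)]

/-! ### Locality of the connection and of the curvature -/

theorem leviCivita_congr {Y Y' : Π x : M, TangentSpace I x} {x : M}
    (h : ∀ᶠ y in nhds x, Y y = Y' y) : leviCivita Y x = leviCivita Y' x := by
  have hT : (T% Y) =ᶠ[nhds x] (T% Y') := by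
    filter_upwards [h] with y hy
    simp [hy]
  by_cases hY : MDiffAt (T% Y) x
  · exact (leviCivita (I := I)).isCovariantDerivativeOnUniv.congr_of_eventuallyEq hY
      (hY.congr_of_eventuallyEq hT.symm) Filter.univ_mem h
  -- where `Y` is not differentiable, neither is `Y'`, and both sides are the junk value `0`
  · have hY' : ¬ MDiffAt (T% Y') x := fun h' => hY (h'.congr_of_eventuallyEq hT)
    change leviCivitaFun Y x = leviCivitaFun Y' x
    rw [leviCivitaFun, leviCivitaFun, dif_neg hY, dif_neg hY']

theorem nabla_congr {X X' Y Y' : Π x : M, TangentSpace I x} {x : M}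
    (hX : X x = X' x) (hY : ∀ᶠ y in nhds x, Y y = Y' y) : nabla X Y x = nabla X' Y' x := by
  rw [nabla, nabla, leviCivita_congr hY, hX]

theorem curvature_congr {X X' Y Y' Z Z' : Π x : M, TangentSpace I x} {x : M}
    (hX : ∀ᶠ y in nhds x, X y = X' y) (hY : ∀ᶠ y in nhds x, Y y = Y' y)
    (hZ : ∀ᶠ y in nhds x, Z y = Z' y) : curvature X Y Z x = curvature X' Y' Z' x := by
  have hXZ : ∀ᶠ y in nhds x, nabla X Z y = nabla X' Z' y :=
    (hX.and hZ.eventually_nhds).mono fun y hy => nabla_congr hy.1 hy.2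
  have hYZ : ∀ᶠ y in nhds x, nabla Y Z y = nabla Y' Z' y :=
    (hY.and hZ.eventually_nhds).mono fun y hy => nabla_congr hy.1 hy.2
  have hbr : mlieBracket I X Y x = mlieBracket I X' Y' x :=
    Filter.EventuallyEq.mlieBracket_vectorField_eq hX hY
  simp only [curvature, Pi.sub_apply]
  rw [nabla_congr hX.self_of_nhds hYZ, nabla_congr hY.self_of_nhds hXZ, nabla_congr hbr hZ]

theorem ricci_congr {Y Y' Z Z' : Π x : M, TangentSpace I x} {x : M}
    (hY : ∀ᶠ y in nhds x, Y y = Y' y) (hZ : ∀ᶠ y in nhds x, Z y = Z' y) :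
    ricci Y Z x = ricci Y' Z' x := by
  simp only [ricci]
  exact Finset.sum_congr rfl fun i _ => by
    rw [curvature_congr (Filter.Eventually.of_forall fun _ => rfl) hY hZ]

/-! ### Curvature of a torse-forming field -/

/-- `R(X, Y)V = θ(X) Y - θ(Y) X` for the 1-form `θ = da - a ψ`. The terms along `V` cancel because
`ψ` is Codazzi. -/
theorem curvature_torseForming {V X Y : Π x : M, TangentSpace I x} {a : M → ℝ}
    {ψ : Π x : M, TangentSpace I x →L[ℝ] ℝ} (hV : ContMDiff I I.tangent ∞ (T% V))
    (hX : ContMDiff I I.tangent ∞ (T% X)) (hY : ContMDiff I I.tangent ∞ (T% Y))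
    (ha : ContMDiff I 𝓘(ℝ) ∞ a) (hψ : IsSmoothOneForm ψ) (htf : IsTorseForming V a ψ)
    (hcod : IsCodazzi ψ) (x : M) :
    curvature X Y V x = (mvfderiv I a x - a x • ψ x) (X x) • Y x
      - (mvfderiv I a x - a x • ψ x) (Y x) • X x := by
  have hnabla : ∀ W : Π x : M, TangentSpace I x,
      nabla W V = a • W + (fun y => ψ y (W y)) • V := fun W => funext fun y => htf y (W y)
  have hmd : ∀ {W : Π x : M, TangentSpace I x}, ContMDiff I I.tangent ∞ (T% W) →
      MDiffAt (T% W) x := fun hW => (hW x).mdifferentiableAt (by simp)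
  have hda : MDiffAt a x := (ha x).mdifferentiableAt (by simp)
  -- the second covariant derivative, by the Leibniz rule
  have hsecond : ∀ U W : Π x : M, TangentSpace I x, ContMDiff I I.tangent ∞ (T% W) →
      nabla U (nabla W V) x = a x • nabla U W x + mvfderiv I a x (U x) • W x
        + (ψ x (W x) • (a x • U x + ψ x (U x) • V x)
          + mvfderiv I (fun y => ψ y (W y)) x (U x) • V x) := by
    intro U W hW
    have hdψ := mdifferentiableAt_oneForm_apply hψ hW x
    rw [hnabla W, ← htf x (U x)]
    simp only [nabla]
    rw [(leviCivita (I := I)).isCovariantDerivativeOnUniv.add (hda.smul_section (hmd hW))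
        (hdψ.smul_section (hmd hV)),
      (leviCivita (I := I)).isCovariantDerivativeOnUniv.leibniz (hmd hW) hda,
      (leviCivita (I := I)).isCovariantDerivativeOnUniv.leibniz (hmd hV) hdψ]
    simp
  have htors : nabla X Y x - nabla Y X x = mlieBracket I X Y x :=
    leviCivita_torsionFree (hmd hX) (hmd hY)
  have hc := hcod X Y hX hY x
  simp only [nablaOneForm] at hc
  have hc' : mvfderiv I (fun y => ψ y (Y y)) x (X x) = mvfderiv I (fun y => ψ y (X y)) x (Y x)
      + ψ x (nabla X Y x) - ψ x (nabla Y X x) := by linarith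
  simp only [curvature, Pi.sub_apply]
  rw [hsecond X Y hY, hsecond Y X hX, hnabla (mlieBracket I X Y), hc']
  simp only [Pi.add_apply, Pi.smul_apply', ← htors, map_sub]
  simp only [sub_apply, smul_apply, smul_eq_mul]
  module

/-- The contraction of `curvature_torseForming`. -/
theorem ricci_torseForming [T2Space M] {V Y : Π x : M, TangentSpace I x} {a : M → ℝ}
    {ψ : Π x : M, TangentSpace I x →L[ℝ] ℝ} (hV : ContMDiff I I.tangent ∞ (T% V))
    (hY : ContMDiff I I.tangent ∞ (T% Y))
    (ha : ContMDiff I 𝓘(ℝ) ∞ a) (hψ : IsSmoothOneForm ψ) (htf : IsTorseForming V a ψ)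
    (hcod : IsCodazzi ψ) (x : M) :
    ricci Y V x = -((Module.finrank ℝ E : ℝ) - 1) * (mvfderiv I a x - a x • ψ x) (Y x) := by
  set b := stdOrthonormalBasis ℝ (TangentSpace I x) with hb
  set θ : TangentSpace I x →L[ℝ] ℝ := mvfderiv I a x - a x • ψ x with hθ
  have hterm : ∀ i, inner ℝ (curvature (FiberBundle.extend E (b i)) Y V x) (b i)
      = θ (b i) * inner ℝ (Y x) (b i) - θ (Y x) * inner ℝ (b i) (b i) := by
    intro i
    obtain ⟨X, hX, hXb⟩ := exists_contMDiff_eventuallyEq_extend (I := I) (b i)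
    have hXx : X x = b i := by rw [← hXb.self_of_nhds, FiberBundle.extend_apply_self]
    rw [curvature_congr hXb (.of_forall fun _ => rfl) (.of_forall fun _ => rfl),
      curvature_torseForming hV hX hY ha hψ htf hcod, hXx, inner_sub_left, real_inner_smul_left,
      real_inner_smul_left]
  simp only [ricci]
  rw [Finset.sum_congr rfl fun i _ => hterm i, Finset.sum_sub_distrib, ← Finset.mul_sum,
    sum_clm_mul_inner, sum_inner_self, Fintype.card_fin]
  change _ - _ * (Module.finrank ℝ E : ℝ) = _
  ring

/-! ### Almost Einstein solitons with torse-forming potential -/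

/-- `(L_V g)(X, Y) = g(∇_X V, Y) + g(X, ∇_Y V)`. -/
theorem lieDerivMetric_eq {V X Y : Π x : M, TangentSpace I x} {x : M} (hV : MDiffAt (T% V) x)
    (hX : MDiffAt (T% X) x) (hY : MDiffAt (T% Y) x) :
    lieDerivMetric V X Y x
      = inner ℝ (leviCivita V x (X x)) (Y x) + inner ℝ (X x) (leviCivita V x (Y x)) := by
  rw [lieDerivMetric, leviCivita_metric hV hX hY, ← leviCivita_torsionFree hV hX,
    ← leviCivita_torsionFree hV hY, inner_sub_left, inner_sub_right]
  ring

/-- The soliton equation after substitution of `∇V = a I + ψ ⊗ V`. -/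
theorem IsAlmostEinsteinSoliton.ricci_eq {V X Y : Π x : M, TangentSpace I x} {lam a : M → ℝ}
    {ψ : Π x : M, TangentSpace I x →L[ℝ] ℝ} (hs : IsAlmostEinsteinSoliton V lam)
    (htf : IsTorseForming V a ψ) (hX : ContMDiff I I.tangent ∞ (T% X))
    (hY : ContMDiff I I.tangent ∞ (T% Y)) (x : M) :
    ricci X Y x = (scal I x / 2 + lam x - a x) * inner ℝ (X x) (Y x)
      - (1 / 2) * (ψ x (X x) * inner ℝ (V x) (Y x) + ψ x (Y x) * inner ℝ (V x) (X x)) := by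
  have h := hs.soliton_eq X Y hX hY x
  rw [lieDerivMetric_eq ((hs.contMDiff_field x).mdifferentiableAt (by simp))
    ((hX x).mdifferentiableAt (by simp)) ((hY x).mdifferentiableAt (by simp)), htf, htf] at h
  simp only [inner_add_left, inner_add_right, real_inner_smul_left, real_inner_smul_right] at h
  rw [real_inner_comm (V x) (X x)] at h
  linarith

/-- The trace of the soliton equation. -/
theorem IsAlmostEinsteinSoliton.scal_eq [T2Space M] {V : Π x : M, TangentSpace I x}
    {lam a : M → ℝ} {ψ : Π x : M, TangentSpace I x →L[ℝ] ℝ} (hs : IsAlmostEinsteinSoliton V lam)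
    (htf : IsTorseForming V a ψ) (x : M) :
    scal I x = (scal I x / 2 + lam x - a x) * Module.finrank ℝ E - ψ x (V x) := by
  set b := stdOrthonormalBasis ℝ (TangentSpace I x) with hb
  have hterm : ∀ i, ricci (I := I) (FiberBundle.extend E (b i)) (FiberBundle.extend E (b i)) x
      = (scal I x / 2 + lam x - a x) * inner ℝ (b i) (b i)
        - ψ x (b i) * inner ℝ (V x) (b i) := by
    intro i
    obtain ⟨X, hX, hXb⟩ := exists_contMDiff_eventuallyEq_extend (I := I) (b i)
    have hXx : X x = b i := by rw [← hXb.self_of_nhds, FiberBundle.extend_apply_self]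
    rw [ricci_congr hXb hXb, hs.ricci_eq htf hX hX, hXx]
    ring
  conv_lhs => rw [scal]
  rw [Finset.sum_congr rfl fun i _ => hterm i, Finset.sum_sub_distrib, ← Finset.mul_sum,
    sum_clm_mul_inner, sum_inner_self, Fintype.card_fin]
  rfl

/-- The formula for `λ`: eliminate `scal` between the soliton equation at `(V, V)`, where the Ricci
term is given by `ricci_torseForming`, and its trace. -/
theorem IsAlmostEinsteinSoliton.lam_eq [T2Space M] {V : Π x : M, TangentSpace I x}
    {lam a : M → ℝ} {ψ : Π x : M, TangentSpace I x →L[ℝ] ℝ} (hs : IsAlmostEinsteinSoliton V lam)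
    (ha : ContMDiff I 𝓘(ℝ) ∞ a) (hψ : IsSmoothOneForm ψ) (htf : IsTorseForming V a ψ)
    (hcod : IsCodazzi ψ) (x : M) :
    lam x = a x
      + ((Module.finrank ℝ E : ℝ) - 1) * ((Module.finrank ℝ E : ℝ) - 2) / (2 * ‖V x‖ ^ 2)
        * mvfderiv I a x (V x)
      - 1 / (2 * ‖V x‖ ^ 2)
        * (((Module.finrank ℝ E : ℝ) - 1) * ((Module.finrank ℝ E : ℝ) - 2) * a x
          + ((Module.finrank ℝ E : ℝ) - 3) * ‖V x‖ ^ 2) * ψ x (V x) := by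
  have hVV := hs.ricci_eq htf hs.contMDiff_field hs.contMDiff_field x
  rw [ricci_torseForming hs.contMDiff_field hs.contMDiff_field ha hψ htf hcod,
    real_inner_self_eq_norm_sq] at hVV
  simp only [sub_apply, smul_apply, smul_eq_mul] at hVV
  have htr := hs.scal_eq htf x
  have hpos : ‖V x‖ ^ 2 ≠ 0 := pow_ne_zero 2 (norm_ne_zero_iff.2 (hs.ne_zero x))
  generalize ‖V x‖ ^ 2 = q at *
  generalize (Module.finrank ℝ E : ℝ) = n at *
  generalize scal I x = S at *
  field_simp
  linear_combination (n - 2) * hVV - q * htr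

/-- A field with `∇V = c I` is torse-forming with `ψ = 0`, so the formula for `λ` reduces to
`λ = c`; then the trace forces `scal = 0`, as the dimension is not `2`, and the soliton equation becomes
`Ric = 0`. -/
theorem IsAlmostEinsteinSoliton.concircular_const [T2Space M] {V : Π x : M, TangentSpace I x}
    {lam : M → ℝ} {c : ℝ} (hs : IsAlmostEinsteinSoliton V lam)
    (hn : Module.finrank ℝ E ≠ 2) (hc : IsConcircular V (fun _ => c)) :
    (∀ x, lam x = c) ∧ IsRicciFlat I M := by
  have htf : IsTorseForming V (fun _ => c) 0 := fun x u => by simp [hc x u]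
  have hψ : IsSmoothOneForm (0 : Π x : M, TangentSpace I x →L[ℝ] ℝ) :=
    contMDiff_zeroSection ℝ (F := E →L[ℝ] ℝ) (fun x : M => TangentSpace I x →L[ℝ] ℝ)
  have hcod : IsCodazzi (0 : Π x : M, TangentSpace I x →L[ℝ] ℝ) := fun X Y _ _ x => by
    simp [nablaOneForm, mvfderiv_const]
  have hlam : ∀ x, lam x = c := fun x => by
    simpa [mvfderiv_const] using hs.lam_eq contMDiff_const hψ htf hcod x
  refine ⟨hlam, fun X Y hX hY x => ?_⟩
  have htr := hs.scal_eq htf x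
  have hscal : scal I x = 0 := by
    have h0 : ((Module.finrank ℝ E : ℝ) - 2) * scal I x = 0 := by
      rw [hlam x] at htr
      simp at htr
      linarith
    exact (mul_eq_zero.1 h0).resolve_left (sub_ne_zero.2 (by exact_mod_cast hn))
  rw [hs.ricci_eq htf hX hY, hscal, hlam x]
  simp

end RiemGeom

theorem mainTheorem4 {n : ℕ} (hn : 3 ≤ n) {M : Type*} [TopologicalSpace M] [T2Space M]
    [SecondCountableTopology M] [ChartedSpace (EuclideanSpace ℝ (Fin n)) M] [IsManifold (𝓡 n) ∞ M]
    [RiemannianBundle (fun x : M => TangentSpace (𝓡 n) x)]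
    [IsContMDiffRiemannianBundle (𝓡 n) ∞ (EuclideanSpace ℝ (Fin n))
      (fun x : M => TangentSpace (𝓡 n) x)]
    (V : Π x : M, TangentSpace (𝓡 n) x) (lam : M → ℝ)
    (hV : RiemGeom.IsAlmostEinsteinSoliton V lam) :
    (∀ (a : M → ℝ) (ψ : Π x : M, TangentSpace (𝓡 n) x →L[ℝ] ℝ),
      ContMDiff (𝓡 n) 𝓘(ℝ) ∞ a → RiemGeom.IsSmoothOneForm ψ →
      RiemGeom.IsTorseForming V a ψ → RiemGeom.IsCodazzi ψ →
      ∀ x, lam x = a x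
        + ((n : ℝ) - 1) * ((n : ℝ) - 2) / (2 * ‖V x‖ ^ 2) * mvfderiv (𝓡 n) a x (V x)
        - 1 / (2 * ‖V x‖ ^ 2)
          * (((n : ℝ) - 1) * ((n : ℝ) - 2) * a x + ((n : ℝ) - 3) * ‖V x‖ ^ 2) * ψ x (V x)) ∧
    (∀ c : ℝ, c ≠ 0 → RiemGeom.IsConcircular V (fun _ => c) →
      (∀ x, lam x = c) ∧ RiemGeom.IsRicciFlat (𝓡 n) M) := by
  refine ⟨fun a ψ ha hψ htf hcod x => ?_, fun c _ hc => hV.concircular_const ?_ hc⟩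
  · simpa using hV.lam_eq ha hψ htf hcod x
  · rw [finrank_euclideanSpace_fin]
    omega
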